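/- Let $f\in\mathbb R[X]=\mathbb R[X_1,\dots,X_n]$ satisfy $f(\mathbf 0)=0$ and have $\mathbf 0$ as an isolated real critical point. Let $\|\cdot\|$ be the Euclidean norm, $\mathsf B_r=\{x\in\mathbb R^n:\|x\|\le r\}$, let $\mathrm{Crit}_{\mathbb R}(f)$ be the set of real critical points of $f$, and let $\Gamma_{\mathbb R}(f)=\{x\in\mathbb R^n:\exists\lambda\in\mathbb R,\ \nabla f(x)=\lambda x\}$. For $S\subseteq\mathbb R[X]$ let $\mathbf V_{\mathbb R}(S)\subseteq\mathbb R^n$ and $\mathbf V_{\mathbb C}(S)\subseteq\mathbb C^n$ be its sets of common real and complex zeros. The dimension of an ideal of $\mathbb R[X]$ is the degree of its affine Hilbert polynomial. A real $R>0$ is an *isolation radius* if $\mathrm{Crit}_{\mathbb R}(f)\cap\mathsf B_R=\{\mathbf 0\}$. An isolation radius $R$ is a *faithful radius* if $\Gamma_{\mathbb R}(f)\cap\mathsf B_R$ is connected and $\Gamma_{\mathbb R}(f)\cap\mathbf V_{\mathbb R}(f)\cap\mathsf B_R=\{\mathbf 0\}$. *Condition 1* for $\mathscr R>0$: for every $u\in\Gamma_{\mathbb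 R}(f)$ with $u\ne\mathbf 0$ and $\|u\|<\mathscr R$ there are an open neighborhood $\mathcal O_u\subseteq\mathsf B_{\mathscr R}$ of $u$, a differentiable map $\phi:(a,b)\to\mathbb R^n$ and $\bar t\in(a,b)$ such that $\phi((a,b))=\Gamma_{\mathbb R}(f)\cap\mathcal O_u$, $\phi(\bar t)=u$ and $\frac{d}{dt}\big(\sum_{i=1}^n\phi_i^2\big)(\bar t)\neq0$. Let $I\subseteq\mathbb R[X]$ be an ideal with $\dim I=1$, and let $I=I^{(0)}\cap I^{(1)}$ be an equidimensional decomposition: all associated primes of $I^{(i)}$ have dimension $i$, for $i=0,1$ (where $I^{(0)}=\mathbb R[X]$ is allowed if $I$ has no zero-dimensional component). Let $\sqrt{I^{(1)}}=\langle g_1,\dots,g_s\rangle$, and let $\Delta$ be the set consisting of $g_1,\dots,g_s$ and the determinants of the Jacobian matrices of $(g_{i_1},\dots,g_{i_{n-1}},\,X_1^2+\cdots+X_n^2)$ for all $\{i_1<\cdots<i_{n-1}\}\subseteq\{1,\dots,s\}$. Put $$\mathscr R_{I^{(0)}}=\inf\{r>0:\exists x\in\mathbf V_{\mathbb C}(I^{(0)}),\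 x_1^2+\cdots+x_n^2=r^2\},$$ $$\mathscr R_{I^{(1)}}=\inf\{r>0:\exists x\in\mathbf V_{\mathbb C}(\Delta),\ x_1^2+\cdots+x_n^2=r^2\},$$ with $r$ ranging over the real numbers and $\inf\emptyset=+\infty$, and $\mathscr R_I=\min\{\mathscr R_{I^{(0)}},\mathscr R_{I^{(1)}}\}$. Let $\mathscr R$ be a real number with $0<\mathscr R<\mathscr R_I$ and $\Gamma_{\mathbb R}(f)\cap\mathsf B_{\mathscr R}=\mathbf V_{\mathbb R}(I)\cap\mathsf B_{\mathscr R}$. Then Condition 1 holds for $\mathscr R$. Consequently, every isolation radius $R<\mathscr R$ is a faithful radius. -/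

import Mathlib

open scoped Topology

noncomputable section

namespace FaithfulRadius

/-! ### Real geometry of a polynomial function: critical points, tangency variety -/

/-- The real critical points of `f`: the common real zeros of its partial derivatives. -/
def critR {n : ℕ} (f : MvPolynomial (Fin n) ℝ) : Set (EuclideanSpace ℝ (Fin n)) :=
  {x | ∀ i, MvPolynomial.eval x.ofLp (MvPolynomial.pderiv i f) = 0}

/-- The tangency variety of `f` at the origin: all `x` with `∇f(x) = c x` for some real `c`. -/
def tangencyR {n : ℕ} (f : MvPolynomial (Fin n) ℝ) : Set (EuclideanSpace ℝ (Fin n)) :=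
  {x | ∃ c : ℝ, ∀ i, MvPolynomial.eval x.ofLp (MvPolynomial.pderiv i f) = c * x i}

/-- The real affine variety of an ideal, as a subset of Euclidean space. -/
def varietyR {n : ℕ} (I : Ideal (MvPolynomial (Fin n) ℝ)) : Set (EuclideanSpace ℝ (Fin n)) :=
  {x | x.ofLp ∈ MvPolynomial.zeroLocus ℝ I}

/-- The origin is an isolated real critical point of `f`. -/
def IsIsolatedCritZero {n : ℕ} (f : MvPolynomial (Fin n) ℝ) : Prop :=
  ∃ O ∈ 𝓝 (0 : EuclideanSpace ℝ (Fin n)), critR f ∩ O = {0}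

/-- `R > 0` is an isolation radius: the origin is the only real critical point of `f` in the
closed ball of radius `R`. -/
def IsIsolationRadius {n : ℕ} (f : MvPolynomial (Fin n) ℝ) (R : ℝ) : Prop :=
  0 < R ∧ critR f ∩ Metric.closedBall 0 R = {0}

/-- A faithful radius: an isolation radius `R` such that the tangency variety is connected inside
the closed ball of radius `R` and meets the zero set of `f` there only at the origin. -/
def IsFaithfulRadius {n : ℕ} (f : MvPolynomial (Fin n) ℝ) (R : ℝ) : Prop :=
  IsIsolationRadius f R ∧
    IsConnected (tangencyR f ∩ Metric.closedBall 0 R) ∧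
    tangencyR f ∩ varietyR (Ideal.span {f}) ∩ Metric.closedBall 0 R = {0}

/-- The curve condition for a radius `ρ`: near each of its nonzero points `u` of norm less than
`ρ`, the tangency variety is the image of a differentiable curve defined on an open interval,
along which the squared norm has nonzero derivative at `u`. -/
def CurveCondition {n : ℕ} (f : MvPolynomial (Fin n) ℝ) (ρ : ℝ) : Prop :=
  ∀ u ∈ tangencyR f, u ≠ 0 → ‖u‖ < ρ →
    ∃ O : Set (EuclideanSpace ℝ (Fin n)),
      IsOpen O ∧ u ∈ O ∧ O ⊆ Metric.closedBall 0 ρ ∧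
      ∃ (a b t₀ : ℝ) (φ : ℝ → EuclideanSpace ℝ (Fin n)),
        t₀ ∈ Set.Ioo a b ∧
        DifferentiableOn ℝ φ (Set.Ioo a b) ∧
        φ '' Set.Ioo a b = tangencyR f ∩ O ∧
        φ t₀ = u ∧
        deriv (fun t => ∑ i, (φ t i) ^ 2) t₀ ≠ 0

/-! ### Hilbert dimension and equidimensional decomposition -/

/-- The affine Hilbert function of `J`: the dimension of `ℝ[X]_{≤ d} / J_{≤ d}`, i.e. of the image
in `ℝ[X] / J` of the space of polynomials of total degree at most `d`. -/
def affineHilbertFunction {n : ℕ} (J : Ideal (MvPolynomial (Fin n) ℝ)) (d : ℕ) : ℕ :=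
  Module.finrank ℝ
    ((MvPolynomial.restrictTotalDegree (Fin n) ℝ d).map (Ideal.Quotient.mkₐ ℝ J).toLinearMap)

/-- `J` has Hilbert dimension `k`: its affine Hilbert polynomial, i.e. the polynomial which agrees
with the affine Hilbert function at all large `d`, has degree `k`. -/
def HasHilbertDim {n : ℕ} (J : Ideal (MvPolynomial (Fin n) ℝ)) (k : ℕ) : Prop :=
  ∃ P : Polynomial ℚ,
    (∀ᶠ d : ℕ in Filter.atTop, (affineHilbertFunction J d : ℚ) = P.eval (d : ℚ)) ∧
    P.degree = (k : WithBot ℕ)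

/-- `J` is pure `k`-dimensional: all its associated primes have dimension `k`. The unit ideal,
which has no associated prime, is allowed; it stands for an absent component. -/
def IsPureDim {n : ℕ} (J : Ideal (MvPolynomial (Fin n) ℝ)) (k : ℕ) : Prop :=
  ∀ P ∈ associatedPrimes (MvPolynomial (Fin n) ℝ) (MvPolynomial (Fin n) ℝ ⧸ J), HasHilbertDim P k

/-- `I = I₀ ∩ I₁` is an equidimensional decomposition of `I` with components of dimensions
`0` and `1`. -/
structure IsEquidimDecomp {n : ℕ} (I I₀ I₁ : Ideal (MvPolynomial (Fin n) ℝ)) : Prop where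
  eq_inf : I = I₀ ⊓ I₁
  pure_zero : IsPureDim I₀ 0
  pure_one : IsPureDim I₁ 1

/-! ### The radius attached to an equidimensional decomposition -/

/-- The polynomial `‖X‖² = X₁² + ⋯ + Xₙ²`. -/
def normSqPoly (n : ℕ) : MvPolynomial (Fin n) ℝ := ∑ i, MvPolynomial.X i ^ 2

/-- The `n` polynomials `g_{i_1}, …, g_{i_{n-1}}, ‖X‖²`. -/
def jacRows {n s : ℕ} (g : Fin s → MvPolynomial (Fin n) ℝ) (e : Fin (n - 1) ↪o Fin s)
    (k : Fin n) : MvPolynomial (Fin n) ℝ :=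
  if h : (k : ℕ) < n - 1 then g (e ⟨k, h⟩) else normSqPoly n

/-- The determinant of the Jacobian matrix of `(g_{i_1}, …, g_{i_{n-1}}, ‖X‖²)`, where
`i_1 < ⋯ < i_{n-1}` are the values of `e`. -/
def jacDet {n s : ℕ} (g : Fin s → MvPolynomial (Fin n) ℝ) (e : Fin (n - 1) ↪o Fin s) :
    MvPolynomial (Fin n) ℝ :=
  (Matrix.of fun k j : Fin n => MvPolynomial.pderiv j (jacRows g e k)).det

/-- The set `Δ`: the generators `g₁, …, g_s` and all the Jacobian determinants `jacDet g e`,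
for the `(n - 1)`-element subsets `{i_1, …, i_{n-1}}` of the index set. -/
def deltaSet {n s : ℕ} (g : Fin s → MvPolynomial (Fin n) ℝ) : Set (MvPolynomial (Fin n) ℝ) :=
  Set.range g ∪ Set.range (jacDet g)

/-- The infimum, in the extended reals, of the real `r > 0` such that `x₁² + ⋯ + xₙ² = r²` for some
point `x` of the complex variety of `J`; it is `+∞` if there is no such `r`. -/
def leastRadius {n : ℕ} (J : Ideal (MvPolynomial (Fin n) ℝ)) : EReal :=
  sInf ((fun r : ℝ => (r : EReal)) ''
    {r : ℝ | 0 < r ∧ ∃ x ∈ MvPolynomial.zeroLocus ℂ J, ∑ i, x i ^ 2 = (r : ℂ) ^ 2})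

/-- The radius attached to the zero-dimensional component `I₀` and to generators `g` of the radical
of the one-dimensional component. -/
def criticalRadius {n s : ℕ} (I₀ : Ideal (MvPolynomial (Fin n) ℝ))
    (g : Fin s → MvPolynomial (Fin n) ℝ) : EReal :=
  min (leastRadius I₀) (leastRadius (Ideal.span (deltaSet g)))

end FaithfulRadius

end

namespace FaithfulRadius

/-! Let `u ≠ 0` be a point of the tangency variety Γ with `‖u‖ < ρ`. Since `ρ` is below both radii,
near `u` the set Γ is the zero set of the `g k`, and some Jacobian determinant `jacDet g e` does not
vanish at `u`. Then `n - 1` of the generators together with `‖X‖²` are local coordinates at `u`. A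
prime of dimension one lies strictly below the maximal ideal of `u`, so Nakayama's lemma shows that
these `n - 1` generators alone cut out Γ near `u` (`exists_eval_ne_zero_mul_mem_span`). The inverse
function theorem then gives a curve parametrised by `‖x‖²` itself, whose squared norm has derivative
`1` (`exists_local_curve`).

For faithfulness, let `∇f(u) = c u`. Along the curve, with velocity `v` at `u`, the derivatives of
`‖x‖²` and `c • f` are `2⟨u, v⟩` and `c²⟨u, v⟩`. Inside an isolation radius `c ≠ 0`, so one can move
along Γ so that both decrease (`CurveCondition.exists_descent`). Hence no nonzero point locally
minimises the norm on Γ, which gives connectedness; minimising `c • f` over the points whose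
multiplier has the sign of `c` shows that `f` has no nonzero zero on Γ. -/

/-! ### Curves through a regular point: algebra -/

/-- If the maximal ideal `m` is generated near its point by `J` and one more element `q`, then every
prime ideal `P` with `J ≤ P < m` agrees with `J` near that point. -/
theorem exists_notMem_mul_mem_of_le_sup_sq {R : Type*} [CommRing R] [IsNoetherianRing R]
    {m P J : Ideal R} {q : R} (hm : m ≠ ⊤) (hqm : q ∈ m)
    (hmJ : m ≤ (J ⊔ Ideal.span {q}) ⊔ m • m)
    (hP : P.IsPrime) (hPm : P < m) (hJP : J ≤ P) :
    ∃ r ∉ m, ∀ p ∈ P, r * p ∈ J := by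
  have unit_mod : ∀ r : R, r - 1 ∈ m → r ∉ m := fun r hr h =>
    hm ((Ideal.eq_top_iff_one m).2 (by simpa using m.sub_mem h hr))
  -- Nakayama in denominator-free form: `r ≡ 1` modulo `m` plays the role of a unit of the
  -- localisation at `m`.
  obtain ⟨r, hr1, hr⟩ := Submodule.exists_sub_one_mem_and_smul_le_of_fg_of_le_sup
    (R := R) (M := R) (I := m) (N := J ⊔ Ideal.span {q}) (N' := m) (P := m)
    (IsNoetherian.noetherian m) le_rfl hmJ
  have hr' : ∀ x ∈ m, r * x ∈ J ⊔ Ideal.span {q} := fun x hx =>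
    hr (Submodule.smul_mem_pointwise_smul x r m hx)
  have hq : q ∉ P := by
    intro hq
    refine hPm.not_ge fun x hx => ?_
    have h1 : r * x ∈ P :=
      (sup_le hJP ((Ideal.span_singleton_le_iff_mem P).2 hq)) (hr' x hx)
    exact (hP.mem_or_mem h1).resolve_left fun h => unit_mod r hr1 (hPm.le h)
  -- Since `q ∉ P`, the coefficient of `q` in the expansion of `r * p` lies in `P`; a second use of
  -- Nakayama then removes `m • P`.
  have hPJ : P ≤ J ⊔ m • P := by
    intro p hp
    obtain ⟨j, hj, b, hb, hjb⟩ := Submodule.mem_sup.1 (hr' p (hPm.le hp))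
    obtain ⟨c, rfl⟩ := Ideal.mem_span_singleton'.1 hb
    have hcq : c * q ∈ P := by
      have : c * q = r * p - j := by rw [← hjb]; ring
      rw [this]
      exact P.sub_mem (P.mul_mem_left _ hp) (hJP hj)
    have hc : c ∈ P := (hP.mem_or_mem hcq).resolve_right hq
    refine Submodule.mem_sup.2 ⟨j, hj, q * c - (r - 1) * p, ?_, ?_⟩
    · exact Submodule.sub_mem _ (Submodule.smul_mem_smul hqm hc) (Submodule.smul_mem_smul hr1 hp)
    · linear_combination hjb
  obtain ⟨t, ht1, ht⟩ := Submodule.exists_sub_one_mem_and_smul_le_of_fg_of_le_sup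
    (R := R) (M := R) (I := m) (N := J) (N' := P) (P := P)
    (IsNoetherian.noetherian P) le_rfl hPJ
  exact ⟨t, unit_mod t ht1, fun p hp => ht (Submodule.smul_mem_pointwise_smul p t P hp)⟩

open MvPolynomial in
/-- First order Taylor expansion of a polynomial modulo the square of the ideal of a point. -/
theorem sub_taylor_mem {n : ℕ} (u : Fin n → ℝ) (p : MvPolynomial (Fin n) ℝ) :
    p - (C (eval u p) + ∑ i, C (eval u (pderiv i p)) * (X i - C (u i))) ∈
      RingHom.ker (eval u) • RingHom.ker (eval u) := by
  have hL : ∀ p : MvPolynomial (Fin n) ℝ,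
      ∑ i, C (eval u (pderiv i p)) * (X i - C (u i)) ∈ RingHom.ker (eval u) := fun p =>
    Ideal.sum_mem _ fun i _ => Ideal.mul_mem_left _ _ (by simp [RingHom.mem_ker])
  have hX : ∀ j : Fin n, (X j : MvPolynomial (Fin n) ℝ) =
      C (eval u (X j)) + ∑ i, C (eval u (pderiv i (X j))) * (X i - C (u i)) := by
    intro j
    rw [Finset.sum_eq_single j]
    · simp
    · intro i _ hij
      rw [pderiv_X_of_ne hij.symm]
      simp
    · simp
  induction p using MvPolynomial.induction_on with
  | C a => simp
  | add p q hp hq =>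
    convert Submodule.add_mem _ hp hq using 1
    simp only [map_add, add_mul, Finset.sum_add_distrib]
    ring
  | mul_X p j hp =>
    have h1 := Ideal.mul_mem_right (X j) _ hp
    -- The product of the two linear parts is all that the Leibniz rule misses, and it lies in the
    -- square.
    have h2 := Submodule.smul_mem_smul (hL p) (hL (X j))
    convert Submodule.add_mem _ h1 h2 using 1
    have h3 : ∑ i, C (eval u (pderiv i (p * X j))) * (X i - C (u i)) =
        C (eval u p) * ∑ i, C (eval u (pderiv i (X j))) * (X i - C (u i)) +
        C (eval u (X j)) * ∑ i, C (eval u (pderiv i p)) * (X i - C (u i)) := by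
      rw [Finset.mul_sum, Finset.mul_sum, ← Finset.sum_add_distrib]
      refine Finset.sum_congr rfl fun i _ => ?_
      simp only [pderiv_mul, map_add, map_mul]
      ring
    rw [h3, map_mul, map_mul, smul_eq_mul]
    have h4 := hX j
    set L := ∑ i, C (eval u (pderiv i (X j : MvPolynomial (Fin n) ℝ))) * (X i - C (u i))
    set M := ∑ i, C (eval u (pderiv i p)) * (X i - C (u i))
    linear_combination (C (eval u p) + M) * h4

open MvPolynomial in
/-- Jacobian criterion: polynomials with invertible Jacobian matrix at `u`, normalised to vanish
at `u`, generate the ideal of `u` modulo its square. -/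
theorem ker_eval_le_of_det_ne_zero {n : ℕ} (u : Fin n → ℝ) (h : Fin n → MvPolynomial (Fin n) ℝ)
    (hdet : (Matrix.of fun k j => eval u (pderiv j (h k))).det ≠ 0) :
    RingHom.ker (eval u) ≤ Ideal.span (Set.range fun k => h k - C (eval u (h k))) ⊔
      RingHom.ker (eval u) • RingHom.ker (eval u) := by
  intro p hp
  set M : Matrix (Fin n) (Fin n) ℝ := Matrix.of fun k j => eval u (pderiv j (h k)) with hM
  -- Coordinates of the gradient of `p` in the basis of gradients of the `h k`: the combination with
  -- these coefficients has the same linear part as `p`.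
  set b : Fin n → ℝ := Matrix.vecMul (fun i => eval u (pderiv i p)) M⁻¹ with hb
  have hbM : ∀ i, eval u (pderiv i p) = ∑ k, b k * eval u (pderiv i (h k)) := by
    intro i
    have : Matrix.vecMul b M = fun i => eval u (pderiv i p) := by
      rw [hb, Matrix.vecMul_vecMul, Matrix.nonsing_inv_mul _ (isUnit_iff_ne_zero.2 hdet),
        Matrix.vecMul_one]
    rw [← congrFun this i]
    rfl
  refine Submodule.mem_sup.2 ⟨∑ k, C (b k) * (h k - C (eval u (h k))), ?_,
    p - ∑ k, C (b k) * (h k - C (eval u (h k))), ?_, by ring⟩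
  · exact Ideal.sum_mem _ fun k _ => Ideal.mul_mem_left _ _ (Ideal.subset_span ⟨k, rfl⟩)
  · have h1 := sub_taylor_mem u p
    have h2 : ∑ k, C (b k) * (h k - (C (eval u (h k)) +
        ∑ i, C (eval u (pderiv i (h k))) * (X i - C (u i)))) ∈
        RingHom.ker (eval u) • RingHom.ker (eval u) :=
      Ideal.sum_mem _ fun k _ => Ideal.mul_mem_left _ _ (sub_taylor_mem u (h k))
    convert Submodule.sub_mem _ h1 h2 using 1
    have h3 : ∑ i, C (eval u (pderiv i p)) * (X i - C (u i)) =
        ∑ k, C (b k) * ∑ i, C (eval u (pderiv i (h k))) * (X i - C (u i)) := by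
      simp_rw [Finset.mul_sum]
      rw [Finset.sum_comm]
      refine Finset.sum_congr rfl fun i _ => ?_
      rw [hbM, map_sum, Finset.sum_mul]
      exact Finset.sum_congr rfl fun k _ => by rw [map_mul]; ring
    rw [h3, show eval u p = 0 from hp]
    simp only [map_zero, mul_sub, mul_add, Finset.sum_sub_distrib, Finset.sum_add_distrib]
    ring

open MvPolynomial in
theorem affineHilbertFunction_ker_eval_le_one {n : ℕ} (u : Fin n → ℝ) (d : ℕ) :
    affineHilbertFunction (RingHom.ker (eval u)) d ≤ 1 := by
  have hspan : ∀ w : MvPolynomial (Fin n) ℝ ⧸ RingHom.ker (eval u), ∃ c : ℝ, c • 1 = w := by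
    intro w
    obtain ⟨p, rfl⟩ := Ideal.Quotient.mk_surjective w
    refine ⟨eval u p, ?_⟩
    rw [← map_one (Ideal.Quotient.mk _), ← Ideal.Quotient.mkₐ_eq_mk ℝ, ← map_smul,
      Ideal.Quotient.mkₐ_eq_mk, Ideal.Quotient.eq, RingHom.mem_ker]
    simp
  have : Module.Finite ℝ (MvPolynomial (Fin n) ℝ ⧸ RingHom.ker (eval u)) :=
    ⟨⟨{1}, by
      rw [eq_top_iff]
      intro w _
      obtain ⟨c, rfl⟩ := hspan w
      exact Submodule.smul_mem _ _ (Submodule.subset_span (by simp))⟩⟩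
  exact (Submodule.finrank_le _).trans (finrank_le_one 1 hspan)

open MvPolynomial in
theorem not_hasHilbertDim_one_ker_eval {n : ℕ} (u : Fin n → ℝ) :
    ¬ HasHilbertDim (RingHom.ker (eval u)) 1 := by
  rintro ⟨P, hP, hdeg⟩
  have h1 := (P.abs_tendsto_atTop (by rw [hdeg]; exact_mod_cast one_pos)).comp
    (tendsto_natCast_atTop_atTop (R := ℚ))
  obtain ⟨d, hd, hd'⟩ := (hP.and (h1.eventually_gt_atTop 1)).exists
  rw [Function.comp_apply, ← hd] at hd'
  have := affineHilbertFunction_ker_eval_le_one u d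
  rw [Nat.abs_cast] at hd'
  exact absurd (by exact_mod_cast hd') this.not_gt

-- A minimal prime over `J` is associated, hence of dimension one, whereas the Hilbert function of a
-- real point is bounded by `1`; the two ideals cannot coincide.
open MvPolynomial in
theorem IsPureDim.exists_prime_lt_ker_eval {n : ℕ} {J : Ideal (MvPolynomial (Fin n) ℝ)}
    (hJ : IsPureDim J 1) {u : Fin n → ℝ} (hu : J ≤ RingHom.ker (eval u)) :
    ∃ P : Ideal (MvPolynomial (Fin n) ℝ), P.IsPrime ∧ J ≤ P ∧ P < RingHom.ker (eval u) := by
  have : (RingHom.ker (eval u)).IsPrime := RingHom.ker_isPrime _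
  obtain ⟨P, hP, hPm⟩ := Ideal.exists_minimalPrimes_le hu
  refine ⟨P, hP.1.1, hP.1.2, lt_of_le_of_ne hPm ?_⟩
  rintro rfl
  refine not_hasHilbertDim_one_ker_eval u (hJ _ ?_)
  apply Module.associatedPrimes.minimalPrimes_annihilator_subset_associatedPrimes
  rwa [Ideal.annihilator_quotient]

open MvPolynomial in
/-- Near a real point where `n - 1` of the generators of a pure one-dimensional radical ideal have
independent gradients, these generators cut out the variety of the ideal. -/
theorem exists_eval_ne_zero_mul_mem_span {n s : ℕ} {I₁ : Ideal (MvPolynomial (Fin n) ℝ)}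
    (hI₁ : IsPureDim I₁ 1) (g : Fin s → MvPolynomial (Fin n) ℝ)
    (hg : Ideal.span (Set.range g) = I₁.radical) {u : Fin n → ℝ}
    (hu : I₁ ≤ RingHom.ker (eval u)) (e : Fin (n - 1) ↪o Fin s) (hdet : eval u (jacDet g e) ≠ 0) :
    ∃ r : MvPolynomial (Fin n) ℝ, eval u r ≠ 0 ∧
      ∀ k, r * g k ∈ Ideal.span (Set.range (g ∘ e)) := by
  obtain ⟨P, hP, hIP, hPm⟩ := hI₁.exists_prime_lt_ker_eval hu
  have hgP : ∀ k, g k ∈ P := fun k => by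
    have : I₁.radical ≤ P := hP.radical_le_iff.2 hIP
    exact this (hg ▸ Ideal.subset_span ⟨k, rfl⟩)
  have hgu : ∀ k, eval u (g k) = 0 := fun k => hPm.le (hgP k)
  set q := normSqPoly n - C (eval u (normSqPoly n)) with hq
  have hJ := ker_eval_le_of_det_ne_zero u (jacRows g e) (by
    rwa [jacDet, RingHom.map_det] at hdet)
  have hspan : Ideal.span (Set.range fun k => jacRows g e k - C (eval u (jacRows g e k))) ≤
      Ideal.span (Set.range (g ∘ e)) ⊔ Ideal.span {q} := by
    refine Ideal.span_le.2 ?_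
    rintro _ ⟨k, rfl⟩
    by_cases hk : (k : ℕ) < n - 1
    · refine Ideal.mem_sup_left (Ideal.subset_span ⟨⟨k, hk⟩, ?_⟩)
      simp [jacRows, hk, hgu]
    · refine Ideal.mem_sup_right (Ideal.subset_span ?_)
      simp [jacRows, hk, hq]
  have hJP : Ideal.span (Set.range (g ∘ e)) ≤ P := by
    refine Ideal.span_le.2 ?_
    rintro _ ⟨k, rfl⟩
    exact hgP _
  obtain ⟨r, hr, h⟩ := exists_notMem_mul_mem_of_le_sup_sq (q := q)
    (J := Ideal.span (Set.range (g ∘ e))) (RingHom.ker_ne_top _)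
    (by simp [hq, RingHom.mem_ker]) (hJ.trans (sup_le_sup_right hspan _)) hP hPm hJP
  exact ⟨r, hr, fun k => h _ (hgP k)⟩

/-! ### Curves through a regular point: analysis -/

open MvPolynomial in
theorem hasFDerivAt_eval {n : ℕ} (p : MvPolynomial (Fin n) ℝ) (x : EuclideanSpace ℝ (Fin n)) :
    HasFDerivAt (fun y : EuclideanSpace ℝ (Fin n) => eval y.ofLp p)
      (∑ i, eval x.ofLp (pderiv i p) • (EuclideanSpace.proj i : EuclideanSpace ℝ (Fin n) →L[ℝ] ℝ)) x := by
  induction p using MvPolynomial.induction_on with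
  | C a => simpa using hasFDerivAt_const a x
  | add p q hp hq =>
    refine ((hp.add hq).congr_fderiv ?_).congr_of_eventuallyEq (.of_forall fun y => by simp)
    simp only [map_add, add_smul, Finset.sum_add_distrib]
  | mul_X p j hp =>
    have hX : HasFDerivAt (fun y : EuclideanSpace ℝ (Fin n) => y j)
        (EuclideanSpace.proj j : EuclideanSpace ℝ (Fin n) →L[ℝ] ℝ) x :=
      (EuclideanSpace.proj j : EuclideanSpace ℝ (Fin n) →L[ℝ] ℝ).hasFDerivAt
    refine ((hp.mul hX).congr_fderiv ?_).congr_of_eventuallyEq (.of_forall fun y => by simp)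
    ext v
    simp [pderiv_X, Pi.single_apply, add_mul, Finset.sum_add_distrib, Finset.mul_sum,
      apply_ite, ite_mul, mul_assoc]

open MvPolynomial in
theorem contDiff_eval {n : ℕ} {k : WithTop ℕ∞} (p : MvPolynomial (Fin n) ℝ) :
    ContDiff ℝ k (fun y : EuclideanSpace ℝ (Fin n) => eval y.ofLp p) := by
  induction p using MvPolynomial.induction_on with
  | C a => simpa using contDiff_const
  | add p q hp hq => simpa using hp.add hq
  | mul_X p j hp =>
    simpa using hp.mul (EuclideanSpace.proj j : EuclideanSpace ℝ (Fin n) →L[ℝ] ℝ).contDiff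

open MvPolynomial in
/-- If `n` polynomials have invertible Jacobian matrix at `u`, then fixing the values of all of them
except the one with index `k₀` defines near `u` a curve parametrised by the value of the latter. -/
theorem exists_local_curve {n : ℕ} (h : Fin n → MvPolynomial (Fin n) ℝ) (k₀ : Fin n)
    (u : EuclideanSpace ℝ (Fin n))
    (hdet : (Matrix.of fun k j => eval u.ofLp (pderiv j (h k))).det ≠ 0)
    {U : Set (EuclideanSpace ℝ (Fin n))} (hU : U ∈ 𝓝 u) :
    ∃ O : Set (EuclideanSpace ℝ (Fin n)), IsOpen O ∧ u ∈ O ∧ O ⊆ U ∧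
      ∃ (a b t₀ : ℝ) (φ : ℝ → EuclideanSpace ℝ (Fin n)),
        t₀ ∈ Set.Ioo a b ∧ DifferentiableOn ℝ φ (Set.Ioo a b) ∧
        φ '' Set.Ioo a b = {x | ∀ k ≠ k₀, eval x.ofLp (h k) = eval u.ofLp (h k)} ∩ O ∧
        φ t₀ = u ∧ ∀ t ∈ Set.Ioo a b, eval (φ t).ofLp (h k₀) = t := by
  set M : Matrix (Fin n) (Fin n) ℝ := Matrix.of fun k j => eval u.ofLp (pderiv j (h k)) with hM
  set F : EuclideanSpace ℝ (Fin n) → (Fin n → ℝ) := fun x k => eval x.ofLp (h k) with hF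
  have hFc : ContDiff ℝ 1 F := contDiff_pi.2 fun k => contDiff_eval (h k)
  have : Invertible M := M.invertibleOfIsUnitDet (isUnit_iff_ne_zero.2 hdet)
  let F' : EuclideanSpace ℝ (Fin n) ≃L[ℝ] (Fin n → ℝ) :=
    (EuclideanSpace.equiv (Fin n) ℝ).trans (M.toLinearEquiv' this).toContinuousLinearEquiv
  have hF' : HasFDerivAt F (F' : EuclideanSpace ℝ (Fin n) →L[ℝ] (Fin n → ℝ)) u := by
    rw [hasFDerivAt_pi']
    intro k
    refine (hasFDerivAt_eval (h k) u).congr_fderiv ?_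
    ext v
    simp [F', hM, Matrix.toLinearEquiv', Matrix.mulVec, dotProduct]
  let E := hFc.contDiffAt.toOpenPartialHomeomorph F hF' one_ne_zero
  have hEF : ∀ x, E x = F x := fun x => rfl
  have huE : u ∈ E.source := hFc.contDiffAt.mem_toOpenPartialHomeomorph_source hF' one_ne_zero
  have hFuE : F u ∈ E.target := E.map_source huE
  have hEu : E.symm (F u) = u := E.left_inv huE
  have hdiff : ∀ᶠ y in 𝓝 (F u), DifferentiableAt ℝ E.symm y := by
    have : ContDiffAt ℝ 1 E.symm (F u) := hFc.contDiffAt.to_localInverse hF' one_ne_zero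
    filter_upwards [this.eventually (by simp)] with y hy
    exact hy.differentiableAt one_ne_zero
  have hU' : ∀ᶠ y in 𝓝 (F u), E.symm y ∈ U :=
    (E.continuousAt_symm hFuE).eventually_mem (by rwa [hEu])
  obtain ⟨ε, hε, hball⟩ := Metric.eventually_nhds_iff_ball.1
    (hdiff.and (hU'.and (E.open_target.eventually_mem hFuE)))
  -- In the sup metric a ball is a cube, so its slice along the coordinate `k₀` is a full interval.
  have hupd : ∀ t ∈ Set.Ioo (F u k₀ - ε) (F u k₀ + ε),
      Function.update (F u) k₀ t ∈ Metric.ball (F u) ε := by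
    intro t ht
    rw [Metric.mem_ball, dist_pi_lt_iff hε]
    intro k
    by_cases hk : k = k₀
    · subst hk
      rw [Function.update_self, Real.dist_eq, abs_lt]
      constructor <;> linarith [ht.1, ht.2]
    · simpa [hk] using hε
  refine ⟨E.source ∩ F ⁻¹' Metric.ball (F u) ε,
    E.open_source.inter (Metric.isOpen_ball.preimage hFc.continuous),
    ⟨huE, Metric.mem_ball_self hε⟩, ?_, F u k₀ - ε, F u k₀ + ε, F u k₀,
    fun t => E.symm (Function.update (F u) k₀ t), ⟨by linarith, by linarith⟩, ?_, ?_, ?_, ?_⟩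
  · rintro x ⟨hx, hxb⟩
    have := (hball _ hxb).2.1
    rwa [← hEF, E.left_inv hx] at this
  · intro t ht
    have h1 : DifferentiableAt ℝ (fun t : ℝ => Function.update (F u) k₀ t) t :=
      (hasDerivAt_update (F u) k₀ t).differentiableAt
    exact (DifferentiableAt.comp t (hball _ (hupd t ht)).1 h1).differentiableWithinAt
  · ext x
    constructor
    · rintro ⟨t, ht, rfl⟩
      have h1 := (hball _ (hupd t ht)).2.2
      have h2 : F (E.symm (Function.update (F u) k₀ t)) = _ := E.right_inv h1
      refine ⟨fun k hk => ?_, E.map_target h1, ?_⟩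
      · have := congrFun h2 k
        rwa [Function.update_of_ne hk] at this
      · rw [Set.mem_preimage, h2]
        exact hupd t ht
    · rintro ⟨hx, hxE, hxb⟩
      refine ⟨F x k₀, ?_, ?_⟩
      · have := (dist_pi_lt_iff hε).1 hxb k₀
        rw [Real.dist_eq, abs_lt] at this
        constructor <;> linarith [this.1, this.2]
      · have : Function.update (F u) k₀ (F x k₀) = F x := by
          ext k
          by_cases hk : k = k₀
          · subst hk; simp
          · rw [Function.update_of_ne hk]
            exact (hx k hk).symm
        change E.symm _ = x
        rw [this, ← hEF, E.left_inv hxE]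
  · change E.symm _ = u
    rw [Function.update_eq_self, hEu]
  · intro t ht
    have h2 : F (E.symm (Function.update (F u) k₀ t)) = _ := E.right_inv (hball _ (hupd t ht)).2.2
    have := congrFun h2 k₀
    rwa [Function.update_self] at this

/-! ### The curve condition -/

/-- A common real zero `x`, viewed as a complex point, would make `r = ‖x‖ ≤ ρ` a competitor in the
infimum. -/
theorem exists_eval_ne_zero_of_lt_leastRadius {n : ℕ} {J : Ideal (MvPolynomial (Fin n) ℝ)} {ρ : ℝ}
    (h : (ρ : EReal) < leastRadius J) {x : EuclideanSpace ℝ (Fin n)} (hx0 : x ≠ 0)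
    (hx : ‖x‖ ≤ ρ) {S : Set (MvPolynomial (Fin n) ℝ)} (hS : Ideal.span S = J) :
    ∃ p ∈ S, MvPolynomial.eval x.ofLp p ≠ 0 := by
  subst hS
  by_contra! hcon
  refine (h.trans_le (sInf_le ⟨‖x‖, ⟨norm_pos_iff.2 hx0, fun i => (x i : ℂ), ?_, ?_⟩, rfl⟩)).not_ge
    (EReal.coe_le_coe_iff.2 hx)
  · rw [MvPolynomial.zeroLocus_span]
    intro p hp
    have h1 := MvPolynomial.aeval_algebraMap_apply ℂ x.ofLp p
    rw [MvPolynomial.aeval_eq_eval, hcon p hp, map_zero] at h1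
    exact h1
  · rw [← Complex.ofReal_pow, EuclideanSpace.real_norm_sq_eq]
    push_cast
    rfl

theorem mem_varietyR_iff {n : ℕ} {I : Ideal (MvPolynomial (Fin n) ℝ)}
    {x : EuclideanSpace ℝ (Fin n)} :
    x ∈ varietyR I ↔ ∀ p ∈ I, MvPolynomial.eval x.ofLp p = 0 := by
  simp [varietyR, MvPolynomial.mem_zeroLocus_iff, MvPolynomial.aeval_eq_eval]

theorem isClosed_varietyR {n : ℕ} (I : Ideal (MvPolynomial (Fin n) ℝ)) :
    IsClosed (varietyR I) := by
  have : varietyR I = ⋂ p ∈ I, {x | MvPolynomial.eval x.ofLp p = 0} := by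
    ext x
    simp [mem_varietyR_iff]
  rw [this]
  exact isClosed_biInter fun p _ =>
    isClosed_eq (contDiff_eval (k := 0) p).continuous continuous_const

theorem eval_normSqPoly {n : ℕ} (x : EuclideanSpace ℝ (Fin n)) :
    MvPolynomial.eval x.ofLp (normSqPoly n) = ∑ i, x i ^ 2 := by
  simp [normSqPoly]

/-- Away from the embedded points, the variety of an ideal agrees with the variety of the radical
of its one-dimensional component. -/
theorem mem_varietyR_iff_of_lt_leastRadius {n s : ℕ} {I I₀ I₁ : Ideal (MvPolynomial (Fin n) ℝ)}
    (hI : I = I₀ ⊓ I₁) {g : Fin s → MvPolynomial (Fin n) ℝ}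
    (hg : Ideal.span (Set.range g) = I₁.radical) {ρ : ℝ} (hρ : (ρ : EReal) < leastRadius I₀)
    {x : EuclideanSpace ℝ (Fin n)} (hx0 : x ≠ 0) (hx : ‖x‖ ≤ ρ) :
    x ∈ varietyR I ↔ ∀ k, MvPolynomial.eval x.ofLp (g k) = 0 := by
  rw [mem_varietyR_iff]
  constructor
  · intro h k
    obtain ⟨q, hq, hqx⟩ :=
      exists_eval_ne_zero_of_lt_leastRadius hρ hx0 hx (S := (I₀ : Set _)) (Ideal.span_eq I₀)
    have hgk : g k ∈ I₁.radical := hg ▸ Ideal.subset_span ⟨k, rfl⟩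
    obtain ⟨N, hN⟩ := hgk
    have h1 := h (q * g k ^ N) (hI ▸ ⟨I₀.mul_mem_right _ hq, I₁.mul_mem_left _ hN⟩)
    rw [map_mul, map_pow] at h1
    exact eq_zero_of_pow_eq_zero ((mul_eq_zero.1 h1).resolve_left hqx)
  · intro h p hp
    have h1 : I₁.radical ≤ RingHom.ker (MvPolynomial.eval x.ofLp) := by
      rw [← hg, Ideal.span_le]
      rintro _ ⟨k, rfl⟩
      exact h k
    rw [hI] at hp
    exact h1 (Ideal.le_radical hp.2)

theorem curveCondition_of_lt_criticalRadius {n : ℕ} {f : MvPolynomial (Fin n) ℝ}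
    {I I₀ I₁ : Ideal (MvPolynomial (Fin n) ℝ)} (hdec : IsEquidimDecomp I I₀ I₁)
    {s : ℕ} {g : Fin s → MvPolynomial (Fin n) ℝ} (hg : Ideal.span (Set.range g) = I₁.radical)
    {ρ : ℝ} (hρI : (ρ : EReal) < criticalRadius I₀ g)
    (hΓ : tangencyR f ∩ Metric.closedBall 0 ρ = varietyR I ∩ Metric.closedBall 0 ρ) :
    CurveCondition f ρ := by
  intro u hu hu0 huρ
  obtain ⟨hρ₀, hρ₁⟩ := lt_min_iff.1 hρI
  have hΓg : ∀ x : EuclideanSpace ℝ (Fin n), x ≠ 0 → ‖x‖ ≤ ρ →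
      (x ∈ tangencyR f ↔ ∀ k, MvPolynomial.eval x.ofLp (g k) = 0) := by
    intro x hx0 hx
    rw [← mem_varietyR_iff_of_lt_leastRadius hdec.eq_inf hg hρ₀ hx0 hx]
    have hxB : x ∈ Metric.closedBall (0 : EuclideanSpace ℝ (Fin n)) ρ := by simpa using hx
    have := Set.ext_iff.1 hΓ x
    simpa only [Set.mem_inter_iff, hxB, and_true] using this
  have hgu := (hΓg u hu0 huρ.le).1 hu
  obtain ⟨p, hp, hpu⟩ := exists_eval_ne_zero_of_lt_leastRadius hρ₁ hu0 huρ.le rfl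
  obtain ⟨e, hdet⟩ : ∃ e, MvPolynomial.eval u.ofLp (jacDet g e) ≠ 0 := by
    rcases hp with ⟨k, rfl⟩ | ⟨e, rfl⟩
    · exact absurd (hgu k) hpu
    · exact ⟨e, hpu⟩
  have hI₁u : I₁ ≤ RingHom.ker (MvPolynomial.eval u.ofLp) := by
    refine Ideal.le_radical.trans ?_
    rw [← hg, Ideal.span_le]
    rintro _ ⟨k, rfl⟩
    exact hgu k
  obtain ⟨r, hru, hr⟩ := exists_eval_ne_zero_mul_mem_span hdec.pure_one g hg hI₁u e hdet
  have hn : 0 < n := by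
    rcases Nat.eq_zero_or_pos n with rfl | h
    · exact absurd (Subsingleton.elim u 0) hu0
    · exact h
  -- The last row of the Jacobian is `‖X‖²`, which is thus the parameter of the curve.
  let k₀ : Fin n := ⟨n - 1, by omega⟩
  have hk₀ : jacRows g e k₀ = normSqPoly n := by simp [jacRows, k₀]
  have hU : ∀ᶠ x in 𝓝 u, x ≠ 0 ∧ ‖x‖ < ρ ∧ MvPolynomial.eval x.ofLp r ≠ 0 :=
    (eventually_ne_nhds hu0).and ((continuous_norm.continuousAt.eventually_lt
      continuousAt_const huρ).and
      ((contDiff_eval (k := 0) r).continuous.continuousAt.eventually_ne hru))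
  obtain ⟨O, hO, huO, hOU, a, b, t₀, φ, ht₀, hφ, himage, hφu, hφt⟩ :=
    exists_local_curve (jacRows g e) k₀ u (by rwa [jacDet, RingHom.map_det] at hdet) hU
  refine ⟨O, hO, huO, fun x hx => by simpa using (hOU hx).2.1.le, a, b, t₀, φ, ht₀, hφ, ?_, hφu, ?_⟩
  · rw [himage]
    ext x
    refine and_congr_left fun hx => ?_
    obtain ⟨hx0, hxρ, hxr⟩ := hOU hx
    rw [hΓg x hx0 hxρ.le, Set.mem_ofPred_eq]
    constructor
    · intro h k
      have h1 : Ideal.span (Set.range (g ∘ e)) ≤ RingHom.ker (MvPolynomial.eval x.ofLp) := by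
        rw [Ideal.span_le]
        rintro _ ⟨j, rfl⟩
        have hj : (⟨j, by omega⟩ : Fin n) ≠ k₀ := by simp [k₀, Fin.ext_iff]; omega
        have := h _ hj
        simpa [jacRows, hgu, RingHom.mem_ker] using this
      have h2 : MvPolynomial.eval x.ofLp (r * g k) = 0 := h1 (hr k)
      rw [map_mul] at h2
      exact (mul_eq_zero.1 h2).resolve_left hxr
    · intro h k hk
      have hk' : (k : ℕ) < n - 1 := by
        have := k.2
        have : (k : ℕ) ≠ n - 1 := fun h => hk (Fin.ext h)
        omega
      simp [jacRows, hk', h, hgu]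
  · have h1 : (fun t => ∑ i, (φ t i) ^ 2) =ᶠ[𝓝 t₀] id := by
      filter_upwards [Ioo_mem_nhds ht₀.1 ht₀.2] with t ht
      rw [← eval_normSqPoly, ← hk₀, hφt t ht, id]
    rw [h1.deriv_eq]
    simp

/-! ### From the curve condition to faithful radii -/

/-- The slope times `d` tends to `d² > 0`. Expressing the side of `t₀` by the sign of `(t - t₀) * d`
treats both signs of `d` at once. -/
theorem eventually_lt_of_hasDerivAt {ψ : ℝ → ℝ} {d t₀ : ℝ} (hψ : HasDerivAt ψ d t₀) (hd : d ≠ 0) :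
    ∀ᶠ t in 𝓝[≠] t₀, (t - t₀) * d < 0 → ψ t < ψ t₀ := by
  have h1 : ∀ᶠ t in 𝓝[≠] t₀, 0 < slope ψ t₀ t * d :=
    ((hasDerivAt_iff_tendsto_slope.1 hψ).mul_const d).eventually_const_lt (mul_self_pos.2 hd)
  filter_upwards [h1, self_mem_nhdsWithin] with t ht htne hlt
  have h2 : (t - t₀) * slope ψ t₀ t = ψ t - ψ t₀ := sub_smul_slope ψ t₀ t
  by_contra! hcon
  have h3 : 0 < (t - t₀) ^ 2 * (slope ψ t₀ t * d) :=
    mul_pos (sq_pos_of_ne_zero (sub_ne_zero.2 htne)) ht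
  have h4 : (ψ t - ψ t₀) * ((t - t₀) * d) ≤ 0 :=
    mul_nonpos_of_nonneg_of_nonpos (sub_nonneg.2 hcon) hlt.le
  rw [← h2] at h4
  linarith

theorem frequently_mul_neg {d t₀ : ℝ} (hd : d ≠ 0) : ∃ᶠ t in 𝓝[≠] t₀, (t - t₀) * d < 0 := by
  rcases hd.lt_or_gt with h | h
  · have h1 : ∀ᶠ t in 𝓝[>] t₀, (t - t₀) * d < 0 := by
      filter_upwards [self_mem_nhdsWithin] with t ht
      exact mul_neg_of_pos_of_neg (sub_pos.2 ht) h
    exact h1.frequently.filter_mono (nhdsWithin_mono _ fun x hx => ne_of_gt hx)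
  · have h1 : ∀ᶠ t in 𝓝[<] t₀, (t - t₀) * d < 0 := by
      filter_upwards [self_mem_nhdsWithin] with t ht
      exact mul_neg_of_neg_of_pos (sub_neg.2 ht) h
    exact h1.frequently.filter_mono (nhdsWithin_mono _ fun x hx => ne_of_lt hx)

/-- Along the tangency variety one can always move closer to the origin, and the value of `c • f`
then decreases, where `∇f(u) = c u`. -/
theorem CurveCondition.exists_descent {n : ℕ} {f : MvPolynomial (Fin n) ℝ} {ρ : ℝ}
    (hf : CurveCondition f ρ) {u : EuclideanSpace ℝ (Fin n)} (hu0 : u ≠ 0) (huρ : ‖u‖ < ρ)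
    {c : ℝ} (hc : ∀ i, MvPolynomial.eval u.ofLp (MvPolynomial.pderiv i f) = c * u i) (hc0 : c ≠ 0)
    {N : Set (EuclideanSpace ℝ (Fin n))} (hN : N ∈ 𝓝 u) :
    ∃ x ∈ tangencyR f ∩ N, ‖x‖ < ‖u‖ ∧
      c * MvPolynomial.eval x.ofLp f < c * MvPolynomial.eval u.ofLp f := by
  obtain ⟨O, -, -, -, a, b, t₀, φ, ht₀, hφ, himage, hφu, hderiv⟩ := hf u ⟨c, hc⟩ hu0 huρ
  have hIoo : Set.Ioo a b ∈ 𝓝 t₀ := Ioo_mem_nhds ht₀.1 ht₀.2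
  have hφ₀ : HasDerivAt φ (deriv φ t₀) t₀ := (hφ.differentiableAt hIoo).hasDerivAt
  set v := deriv φ t₀ with hv
  have hcomp : ∀ p : MvPolynomial (Fin n) ℝ,
      HasDerivAt (fun t => MvPolynomial.eval (φ t).ofLp p)
        (∑ i, MvPolynomial.eval u.ofLp (MvPolynomial.pderiv i p) * v i) t₀ := by
    intro p
    have h1 := hasFDerivAt_eval p u
    rw [← hφu] at h1
    have h2 := h1.comp_hasDerivAt t₀ hφ₀
    rw [hφu] at h2
    refine h2.congr_deriv ?_
    simp
  have hsq : HasDerivAt (fun t => ∑ i, (φ t i) ^ 2) (2 * ∑ i, u i * v i) t₀ := by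
    have h1 := hcomp (normSqPoly n)
    simp only [eval_normSqPoly] at h1
    refine h1.congr_deriv ?_
    rw [Finset.mul_sum]
    refine Finset.sum_congr rfl fun i _ => ?_
    simp [normSqPoly, MvPolynomial.pderiv_X, Pi.single_apply]
    ring
  have hcf : HasDerivAt (fun t => c * MvPolynomial.eval (φ t).ofLp f)
      (c ^ 2 * ∑ i, u i * v i) t₀ := by
    refine ((hcomp f).const_mul c).congr_deriv ?_
    rw [Finset.mul_sum, Finset.mul_sum]
    refine Finset.sum_congr rfl fun i _ => ?_
    rw [hc]
    ring
  rw [hsq.deriv] at hderiv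
  set d := ∑ i, u i * v i with hd
  have hd0 : d ≠ 0 := fun h => hderiv (by rw [h, mul_zero])
  have hφN : ∀ᶠ t in 𝓝 t₀, φ t ∈ N :=
    hφ₀.continuousAt.eventually_mem (by rwa [hφu])
  have hnear : ∀ᶠ t in 𝓝[≠] t₀, t ∈ Set.Ioo a b ∧ φ t ∈ N :=
    (Filter.Eventually.and hIoo hφN).filter_mono nhdsWithin_le_nhds
  -- Both derivatives are positive multiples of `d`, so a single choice of side decreases both
  -- functions.
  obtain ⟨t, htd, ht1, ht2, htI, htN⟩ := ((frequently_mul_neg hd0).and_eventually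
    ((eventually_lt_of_hasDerivAt hsq hderiv).and ((eventually_lt_of_hasDerivAt hcf
      (mul_ne_zero (pow_ne_zero 2 hc0) hd0)).and hnear))).exists
  have hc2 : 0 < c ^ 2 := by positivity
  have hmem : φ t ∈ tangencyR f ∩ O := himage ▸ ⟨t, htI, rfl⟩
  refine ⟨φ t, ⟨hmem.1, htN⟩, ?_, ?_⟩
  · have := ht1 (by nlinarith)
    simp only [hφu, ← EuclideanSpace.real_norm_sq_eq] at this
    exact lt_of_pow_lt_pow_left₀ 2 (norm_nonneg _) this
  · have := ht2 (by nlinarith)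
    rwa [hφu] at this

theorem zero_mem_tangencyR {n : ℕ} {f : MvPolynomial (Fin n) ℝ} (h : 0 ∈ critR f) :
    (0 : EuclideanSpace ℝ (Fin n)) ∈ tangencyR f :=
  ⟨0, fun i => by rw [h i, zero_mul]⟩

theorem IsIsolationRadius.multiplier_ne_zero {n : ℕ} {f : MvPolynomial (Fin n) ℝ} {R : ℝ}
    (hR : IsIsolationRadius f R) {u : EuclideanSpace ℝ (Fin n)} (hu0 : u ≠ 0) (hu : ‖u‖ ≤ R)
    {c : ℝ} (hc : ∀ i, MvPolynomial.eval u.ofLp (MvPolynomial.pderiv i f) = c * u i) : c ≠ 0 := by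
  rintro rfl
  have : u ∈ critR f ∩ Metric.closedBall 0 R := ⟨fun i => by rw [hc, zero_mul], by simpa using hu⟩
  rw [hR.2] at this
  exact hu0 this

theorem IsIsolationRadius.zero_mem {n : ℕ} {f : MvPolynomial (Fin n) ℝ} {R : ℝ}
    (hR : IsIsolationRadius f R) : 0 ∈ tangencyR f ∩ Metric.closedBall 0 R := by
  have : (0 : EuclideanSpace ℝ (Fin n)) ∈ critR f ∩ Metric.closedBall 0 R := by
    rw [hR.2]
    exact Set.mem_singleton 0
  exact ⟨zero_mem_tangencyR this.1, this.2⟩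

/-- If two closed sets separated the compact set, a point of least norm in either piece would be the
origin: otherwise descent, near enough to avoid the other piece, lowers the norm. The origin would
then lie in both. -/
theorem CurveCondition.isConnected {n : ℕ} {f : MvPolynomial (Fin n) ℝ} {ρ R : ℝ}
    (hf : CurveCondition f ρ) (hR : IsIsolationRadius f R) (hRρ : R < ρ)
    (hK : IsCompact (tangencyR f ∩ Metric.closedBall 0 R)) :
    IsConnected (tangencyR f ∩ Metric.closedBall 0 R) := by
  have key : ∀ s t : Set (EuclideanSpace ℝ (Fin n)), IsClosed s → IsClosed t →
      tangencyR f ∩ Metric.closedBall 0 R ⊆ s ∪ t →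
      ((tangencyR f ∩ Metric.closedBall 0 R) ∩ s).Nonempty →
      ¬ ((tangencyR f ∩ Metric.closedBall 0 R) ∩ (s ∩ t)).Nonempty → 0 ∈ s := by
    intro s t hs ht hst hne hdisj
    obtain ⟨u, ⟨⟨huΓ, huR⟩, hus⟩, hmin⟩ :=
      (hK.inter_right hs).exists_isMinOn hne continuous_norm.continuousOn
    rcases eq_or_ne u 0 with rfl | hu0
    · exact hus
    exfalso
    have hut : u ∉ t := fun hut => hdisj ⟨u, ⟨huΓ, huR⟩, hus, hut⟩
    have huR' : ‖u‖ ≤ R := by simpa using huR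
    obtain ⟨c, hc⟩ := huΓ
    obtain ⟨x, ⟨hxΓ, hxt⟩, hxu, -⟩ := hf.exists_descent hu0 (huR'.trans_lt hRρ) hc
      (hR.multiplier_ne_zero hu0 huR' hc) (ht.isOpen_compl.mem_nhds hut)
    have hxK : x ∈ tangencyR f ∩ Metric.closedBall 0 R :=
      ⟨hxΓ, by simpa using (hxu.trans_le huR').le⟩
    exact hxu.not_ge (hmin ⟨hxK, (hst hxK).resolve_right hxt⟩)
  refine ⟨⟨0, hR.zero_mem⟩, isPreconnected_closed_iff.2 fun s t hs ht hst hns hnt => ?_⟩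
  by_contra hcon
  exact hcon ⟨0, hR.zero_mem, key s t hs ht hst hns hcon,
    key t s ht hs (Set.union_comm s t ▸ hst) hnt (Set.inter_comm s t ▸ hcon)⟩

theorem CurveCondition.eval_ne_zero {n : ℕ} {f : MvPolynomial (Fin n) ℝ} {ρ R : ℝ}
    (hf0 : MvPolynomial.eval 0 f = 0)
    (hf : CurveCondition f ρ) (hR : IsIsolationRadius f R) (hRρ : R < ρ)
    (hK : IsCompact (tangencyR f ∩ Metric.closedBall 0 R))
    {u : EuclideanSpace ℝ (Fin n)} (hu : u ∈ tangencyR f) (hu0 : u ≠ 0) (huR : ‖u‖ ≤ R) :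
    MvPolynomial.eval u.ofLp f ≠ 0 := by
  intro hfu
  obtain ⟨c, hc⟩ := hu
  -- On the tangency variety this Euler polynomial equals the multiplier times `‖x‖²`, so the sign
  -- of the multiplier becomes a closed polynomial condition, satisfied at the origin too.
  set E : MvPolynomial (Fin n) ℝ := ∑ i, MvPolynomial.X i * MvPolynomial.pderiv i f with hE
  have hEx : ∀ (x : EuclideanSpace ℝ (Fin n)) (l : ℝ),
      (∀ i, MvPolynomial.eval x.ofLp (MvPolynomial.pderiv i f) = l * x i) →
      MvPolynomial.eval x.ofLp E = l * ‖x‖ ^ 2 := by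
    intro x l hl
    simp only [hE, map_sum, map_mul, MvPolynomial.eval_X, hl, EuclideanSpace.real_norm_sq_eq,
      Finset.mul_sum]
    exact Finset.sum_congr rfl fun i _ => by ring
  have hEc : Continuous fun x : EuclideanSpace ℝ (Fin n) => c * MvPolynomial.eval x.ofLp E :=
    continuous_const.mul (contDiff_eval (k := 0) E).continuous
  have hfc : Continuous fun x : EuclideanSpace ℝ (Fin n) => c * MvPolynomial.eval x.ofLp f :=
    continuous_const.mul (contDiff_eval (k := 0) f).continuous
  have hL : IsCompact ((tangencyR f ∩ Metric.closedBall 0 R) ∩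
      {x | 0 ≤ c * MvPolynomial.eval x.ofLp E}) :=
    hK.inter_right (isClosed_le continuous_const hEc)
  have huL : u ∈ (tangencyR f ∩ Metric.closedBall 0 R) ∩
      {x | 0 ≤ c * MvPolynomial.eval x.ofLp E} := by
    refine ⟨⟨⟨c, hc⟩, by simpa using huR⟩, ?_⟩
    rw [Set.mem_ofPred_eq, hEx u c hc]
    nlinarith [mul_nonneg (sq_nonneg c) (sq_nonneg ‖u‖)]
  have descent : ∀ w ∈ (tangencyR f ∩ Metric.closedBall 0 R) ∩
      {x | 0 ≤ c * MvPolynomial.eval x.ofLp E}, w ≠ 0 →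
      ∃ x ∈ (tangencyR f ∩ Metric.closedBall 0 R) ∩ {x | 0 ≤ c * MvPolynomial.eval x.ofLp E},
        c * MvPolynomial.eval x.ofLp f < c * MvPolynomial.eval w.ofLp f := by
    rintro w ⟨⟨⟨l, hl⟩, hwR⟩, hwE⟩ hw0
    have hwR' : ‖w‖ ≤ R := by simpa using hwR
    have hc0 := hR.multiplier_ne_zero hu0 huR hc
    have hl0 := hR.multiplier_ne_zero hw0 hwR' hl
    have hw2 : 0 < ‖w‖ ^ 2 := pow_pos (norm_pos_iff.2 hw0) 2
    rw [Set.mem_ofPred_eq, hEx w l hl, ← mul_assoc] at hwE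
    have hcl : 0 < c * l :=
      lt_of_le_of_ne (nonneg_of_mul_nonneg_left hwE hw2) (mul_ne_zero hc0 hl0).symm
    have hwE' : 0 < c * MvPolynomial.eval w.ofLp E := by
      rw [hEx w l hl, ← mul_assoc]
      exact mul_pos hcl hw2
    -- Descent within the open set `c * E > 0` keeps the sign of the multiplier; as `c * l > 0`,
    -- decreasing `l * f` also decreases `c * f`.
    obtain ⟨x, ⟨hxΓ, hxE⟩, hxw, hxf⟩ := hf.exists_descent hw0 (hwR'.trans_lt hRρ) hl hl0
      ((isOpen_lt continuous_const hEc).mem_nhds hwE')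
    have hxE' : 0 < c * MvPolynomial.eval x.ofLp E := hxE
    refine ⟨x, ⟨⟨hxΓ, by simpa using (hxw.trans_le hwR').le⟩, hxE'.le⟩, ?_⟩
    have h1 : 0 < l * (MvPolynomial.eval w.ofLp f - MvPolynomial.eval x.ofLp f) := by linarith
    have h2 := mul_pos hcl h1
    have h3 : 0 < l ^ 2 := by positivity
    have h4 : 0 < c * (MvPolynomial.eval w.ofLp f - MvPolynomial.eval x.ofLp f) :=
      (mul_pos_iff_of_pos_left h3).1 (by linarith)
    linarith
  obtain ⟨w, hw, hmin⟩ := hL.exists_isMinOn ⟨u, huL⟩ hfc.continuousOn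
  have hw0 : w = 0 := by
    by_contra hw0
    obtain ⟨x, hx, hxw⟩ := descent w hw hw0
    exact hxw.not_ge (hmin hx)
  subst hw0
  -- The minimum of `c * f` is its value `0` at the origin, yet descent from the zero `u` of `f`
  -- goes strictly below.
  obtain ⟨x, hx, hxu⟩ := descent u huL hu0
  have h1 : c * MvPolynomial.eval (0 : EuclideanSpace ℝ (Fin n)).ofLp f ≤
    c * MvPolynomial.eval x.ofLp f := hmin hx
  rw [WithLp.ofLp_zero, hf0] at h1
  rw [hfu] at hxu
  exact hxu.not_ge h1

theorem CurveCondition.isFaithfulRadius {n : ℕ} {f : MvPolynomial (Fin n) ℝ} {ρ R : ℝ}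
    (hf0 : MvPolynomial.eval 0 f = 0)
    (hf : CurveCondition f ρ) (hR : IsIsolationRadius f R) (hRρ : R < ρ)
    (hK : IsCompact (tangencyR f ∩ Metric.closedBall 0 R)) :
    IsFaithfulRadius f R := by
  refine ⟨hR, hf.isConnected hR hRρ hK, Set.Subset.antisymm ?_ ?_⟩
  · rintro u ⟨⟨hu, huf⟩, huR⟩
    by_contra hu0
    exact hf.eval_ne_zero hf0 hR hRρ hK hu hu0 (by simpa using huR)
      (mem_varietyR_iff.1 huf f (Ideal.mem_span_singleton_self f))
  · rintro _ rfl
    refine ⟨⟨hR.zero_mem.1, mem_varietyR_iff.2 fun p hp => ?_⟩, hR.zero_mem.2⟩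
    obtain ⟨q, rfl⟩ := Ideal.mem_span_singleton'.1 hp
    rw [map_mul, WithLp.ofLp_zero, hf0, mul_zero]

end FaithfulRadius

theorem theorem4p4 (n : ℕ) (f : MvPolynomial (Fin n) ℝ)
    (hf0 : MvPolynomial.eval 0 f = 0) (hiso : FaithfulRadius.IsIsolatedCritZero f)
    (I I₀ I₁ : Ideal (MvPolynomial (Fin n) ℝ))
    (hdim : FaithfulRadius.HasHilbertDim I 1)
    (hdec : FaithfulRadius.IsEquidimDecomp I I₀ I₁)
    (s : ℕ) (g : Fin s → MvPolynomial (Fin n) ℝ)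
    (hg : Ideal.span (Set.range g) = I₁.radical)
    (ρ : ℝ) (hρ : 0 < ρ)
    (hρI : (ρ : EReal) < FaithfulRadius.criticalRadius I₀ g)
    (hΓ : FaithfulRadius.tangencyR f ∩ Metric.closedBall 0 ρ =
      FaithfulRadius.varietyR I ∩ Metric.closedBall 0 ρ) :
    FaithfulRadius.CurveCondition f ρ ∧
      ∀ R : ℝ, FaithfulRadius.IsIsolationRadius f R → R < ρ →
        FaithfulRadius.IsFaithfulRadius f R := by
  have hcurve := FaithfulRadius.curveCondition_of_lt_criticalRadius hdec hg hρI hΓ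
  refine ⟨hcurve, fun R hR hRρ => hcurve.isFaithfulRadius hf0 hR hRρ ?_⟩
  have hball : Metric.closedBall (0 : EuclideanSpace ℝ (Fin n)) ρ ∩ Metric.closedBall 0 R =
      Metric.closedBall 0 R :=
    Set.inter_eq_right.2 (Metric.closedBall_subset_closedBall hRρ.le)
  -- Closedness is not visible in the definition of the tangency variety, with its existential
  -- multiplier; it is read off from the variety of `I`.
  have hK : FaithfulRadius.tangencyR f ∩ Metric.closedBall 0 R =
      Metric.closedBall 0 R ∩ FaithfulRadius.varietyR I := by
    rw [← hball, ← Set.inter_assoc, hΓ, Set.inter_assoc, hball, Set.inter_comm]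
  rw [hK]
  exact (isCompact_closedBall 0 R).inter_right (FaithfulRadius.isClosed_varietyR I)
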